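/- Let $m\le d$, $A\in\mathbb R^{d\times d}$ and $B\in\mathbb R^{d\times m}$. Assume that $(A,B)$ is controllable, i.e. the block matrix $(B,AB,\dots,A^{d-1}B)$ has rank $d$, and that $A$ is Hurwitz, i.e. all its complex eigenvalues have negative real part. Let $W$ be an $m$-dimensional standard Brownian motion on a probability space and, for $x\in\mathbb R^d$, let $(X^x_t)_{t\ge 0}$ be the solution with continuous paths of the SDE $$dX_t = AX_t\,dt + B\,dW_t,\qquad X_0=x .$$ The associated Koopman operators $K^t$, $t\ge 0$, are given by $(K^tf)(x)=\mathbb E[f(X_t)\mid X_0=x]=\mathbb E[f(X^x_t)]$. Let $C\in\mathbb R^{d\times d}$ be a symmetric positive definite matrix such that, in the order of symmetric matrices ($M\le N$ if $N-M$ is positive semidefinite), $$\tfrac12\big(AC^2+C^2A^\top\big)\le BB^\top .$$ Let $\mathbb H_C$, with norm $\|\cdot\|_C$, be the reproducing kernel Hilbert space of real functions on $\mathbb R^d$ generated by the Gaussian kernel $k^C(x,y)=\exp(-\|C^{-1}(x-y)\|^2)$, where $\|\cdot\|$ is the Euclidean norm. Then $\mathbb H_C$ is invariant under each Koopman operator $K^t$,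 $t\ge0$: for every $f\in\mathbb H_C$, the expectation $\mathbb E[f(X^x_t)]$ exists (the integrand is integrable) for every $x\in\mathbb R^d$, $K^tf\in\mathbb H_C$, and $$\|K^tf\|_C\le e^{t\cdot\operatorname{Tr}(-A)/2}\,\|f\|_C .$$ -/

import Mathlib

open MeasureTheory ProbabilityTheory
open scoped NNReal MatrixOrder Matrix

noncomputable section

/-- The pair `(A, B)` is controllable: the `d × (d m)` block matrix `(B, A B, …, A ^ (d - 1) B)`
has full rank `d`. -/
def Controllable {d m : ℕ} (A : Matrix (Fin d) (Fin d) ℝ) (B : Matrix (Fin d) (Fin m) ℝ) : Prop :=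
  (Matrix.of fun (i : Fin d) (kj : Fin d × Fin m) => (A ^ (kj.1 : ℕ) * B) i kj.2).rank = d

/-- A real square matrix is Hurwitz if all its complex eigenvalues have negative real part. -/
def Hurwitz {d : ℕ} (A : Matrix (Fin d) (Fin d) ℝ) : Prop :=
  ∀ z : ℂ, Module.End.HasEigenvalue (Matrix.toLin' (A.map Complex.ofReal)) z → z.re < 0

/-- `W` is an `m`-dimensional standard Brownian motion under `P`: its coordinate processes are
independent real Brownian motions. -/
structure IsBrownianVec {Ω : Type*} [MeasurableSpace Ω] {m : ℕ}
    (W : ℝ≥0 → Ω → EuclideanSpace ℝ (Fin m)) (P : Measure Ω) : Prop where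
  measurable : ∀ t, Measurable (W t)
  brownian : ∀ i, IsBrownianReal (fun t ω => W t ω i) P
  indep : iIndepFun (fun (i : Fin m) (ω : Ω) (t : ℝ≥0) => W t ω i) P

/-- `X` is a (continuous) solution of `dX = A X dt + B dW` with `X 0 = x`. As the noise is additive,
the SDE in integrated form is `X t = x + ∫ s in 0..t, A (X s) ds + B (W t)`. -/
structure IsSolutionSDE {Ω : Type*} [MeasurableSpace Ω] {d m : ℕ}
    (A : Matrix (Fin d) (Fin d) ℝ) (B : Matrix (Fin d) (Fin m) ℝ)
    (W : ℝ≥0 → Ω → EuclideanSpace ℝ (Fin m)) (P : Measure Ω) (x : EuclideanSpace ℝ (Fin d))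
    (X : ℝ≥0 → Ω → EuclideanSpace ℝ (Fin d)) : Prop where
  measurable : ∀ t, Measurable (X t)
  cont : ∀ᵐ ω ∂P, Continuous fun t => X t ω
  eqn : ∀ᵐ ω ∂P, ∀ t : ℝ≥0, X t ω =
    x + (∫ s in (0 : ℝ)..t, Matrix.toEuclideanLin A (X s.toNNReal ω))
      + Matrix.toEuclideanLin B (W t ω)

/-- The Koopman operator at time `t`, `(K^t f)(x) = 𝔼[f (X_t) | X_0 = x]`, where `X x` is the
solution process that starts at `x`. -/
def koopman {Ω : Type*} [MeasurableSpace Ω] {d : ℕ} (P : Measure Ω)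
    (X : EuclideanSpace ℝ (Fin d) → ℝ≥0 → Ω → EuclideanSpace ℝ (Fin d)) (t : ℝ≥0)
    (f : EuclideanSpace ℝ (Fin d) → ℝ) : EuclideanSpace ℝ (Fin d) → ℝ :=
  fun x => ∫ ω, f (X x t ω) ∂P

/-- The Gaussian kernel `k^C(x, y) = exp (-‖C⁻¹ (x - y)‖ ^ 2)`. -/
def gaussianKernel {d : ℕ} (C : Matrix (Fin d) (Fin d) ℝ) (x y : EuclideanSpace ℝ (Fin d)) : ℝ :=
  Real.exp (-‖Matrix.toEuclideanLin C⁻¹ (x - y)‖ ^ 2)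

/-- The Gaussian kernel as a matrix of (scalar) operators on `ℝ`. -/
def gaussianKernelMatrix {d : ℕ} (C : Matrix (Fin d) (Fin d) ℝ) :
    Matrix (EuclideanSpace ℝ (Fin d)) (EuclideanSpace ℝ (Fin d)) (ℝ →L[ℝ] ℝ) :=
  Matrix.of fun x y => gaussianKernel C x y • ContinuousLinearMap.id ℝ ℝ

/-- A Gaussian is the characteristic function of a standard Gaussian measure. -/
theorem exp_neg_norm_sq_eq_integral_cos {d : ℕ} (u : EuclideanSpace ℝ (Fin d)) :
    Real.exp (-‖u‖ ^ 2) =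
      ∫ z, Real.cos (inner ℝ z (Real.sqrt 2 • u))
        ∂(stdGaussian (EuclideanSpace ℝ (Fin d))) := by
  have h := charFun_stdGaussian (E := EuclideanSpace ℝ (Fin d)) (Real.sqrt 2 • u)
  rw [charFun_apply] at h
  have h2 := congrArg Complex.re h
  rw [← RCLike.re_eq_complex_re, ← integral_re] at h2
  · simp only [RCLike.re_eq_complex_re, Complex.exp_ofReal_mul_I_re] at h2
    rw [h2]
    have : (-((‖Real.sqrt 2 • u‖ : ℝ) : ℂ) ^ 2 / 2) = ((-‖u‖ ^ 2 : ℝ) : ℂ) := by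
      rw [norm_smul, Real.norm_of_nonneg (Real.sqrt_nonneg 2), ← Complex.ofReal_pow, mul_pow,
        Real.sq_sqrt (by norm_num)]
      push_cast
      ring
    rw [this, Complex.exp_ofReal_re]
  · refine Integrable.of_bound (by fun_prop) 1 (Filter.Eventually.of_forall fun z => ?_)
    rw [Complex.norm_exp_ofReal_mul_I]

theorem posSemidef_gaussianKernelMatrix {d : ℕ} (C : Matrix (Fin d) (Fin d) ℝ) :
    (gaussianKernelMatrix C).PosSemidef := by
  refine ((RKHS.posSemidef_tfae (𝕜 := ℝ) (K := gaussianKernelMatrix C)).out 0 2).mpr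
    (And.intro ?_ fun v => ?_)
  · ext x y
    have h : (star (ContinuousLinearMap.id ℝ ℝ) : ℝ →L[ℝ] ℝ) = ContinuousLinearMap.id ℝ ℝ :=
      star_one (ℝ →L[ℝ] ℝ)
    simp [gaussianKernelMatrix, gaussianKernel, h, norm_sub_rev]
  · simp only [gaussianKernelMatrix, Matrix.of_apply, gaussianKernel,
      exp_neg_norm_sq_eq_integral_cos, RCLike.re_to_real]
    set u : EuclideanSpace ℝ (Fin d) → EuclideanSpace ℝ (Fin d) :=
      fun x => Real.sqrt 2 • Matrix.toEuclideanLin C⁻¹ x with hu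
    have key : ∀ z, 0 ≤ ∑ x ∈ v.support, ∑ y ∈ v.support,
        v x * v y * Real.cos (inner ℝ z (Real.sqrt 2 • Matrix.toEuclideanLin C⁻¹ (y - x))) := by
      intro z
      have : ∑ x ∈ v.support, ∑ y ∈ v.support,
          v x * v y * Real.cos (inner ℝ z (Real.sqrt 2 • Matrix.toEuclideanLin C⁻¹ (y - x))) =
          (∑ x ∈ v.support, v x * Real.cos (inner ℝ z (u x))) ^ 2 +
          (∑ x ∈ v.support, v x * Real.sin (inner ℝ z (u x))) ^ 2 := by
        simp only [sq, Finset.sum_mul_sum, ← Finset.sum_add_distrib]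
        refine Finset.sum_congr rfl fun x _ => Finset.sum_congr rfl fun y _ => ?_
        rw [map_sub, smul_sub, inner_sub_right, Real.cos_sub]
        simp only [hu]
        ring
      rw [this]
      positivity
    have := integral_nonneg_of_ae
      (μ := stdGaussian (EuclideanSpace ℝ (Fin d))) (Filter.Eventually.of_forall key)
    have hint : ∀ w : EuclideanSpace ℝ (Fin d), Integrable
        (fun z => Real.cos (inner ℝ z w)) (stdGaussian (EuclideanSpace ℝ (Fin d))) := fun w =>
      Integrable.of_bound (by fun_prop) 1 (Filter.Eventually.of_forall fun z => by
        simpa using Real.abs_cos_le_one _)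
    rw [integral_finsetSum _ fun x _ => integrable_finsetSum _ fun y _ => (hint _).const_mul _]
      at this
    refine this.trans_eq ?_
    simp only [Finsupp.sum]
    refine Finset.sum_congr rfl fun x _ => ?_
    rw [integral_finsetSum _ fun y _ => (hint _).const_mul _]
    refine Finset.sum_congr rfl fun y _ => ?_
    rw [integral_const_mul]
    simp
    ring

instance fact_posSemidef_gaussianKernelMatrix {d : ℕ} (C : Matrix (Fin d) (Fin d) ℝ) :
    Fact (gaussianKernelMatrix C).PosSemidef :=
  ⟨posSemidef_gaussianKernelMatrix C⟩

/-- The reproducing kernel Hilbert space `ℍ_C` of real functions on `ℝ^d` generated by the Gaussian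
kernel `k^C`. -/
abbrev GaussianRKHS {d : ℕ} (C : Matrix (Fin d) (Fin d) ℝ) : Type :=
  RKHS.OfKernel (gaussianKernelMatrix C)

end

noncomputable section

/-! By duality, a bound on mean embeddings suffices. Let `k_x` be the kernel function at `x` and
`μ_x` the mean embedding of the law of `X^x_t`, so that `K^t f (x) = ⟪f, μ_x⟫`. If `‖∑ r_x μ_x‖ ≤ M
‖∑ r_x k_x‖` for all finite combinations, then `∑ r_x k_x ↦ ∑ r_x K^t f (x)` is a well-defined
functional of norm at most `M ‖f‖`, and its Riesz representative is `K^t f`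
(`exists_inner_eq_of_bound`).

The bound, with `M = exp (t Tr(-A) / 2)`, is `norm_sum_meanEmbedding_le`. Up to a common constant,
the squared norm of a combination of embeddings is the integral over `v` of `exp (-‖v‖²/4)` times
the squared modulus of the same combination of characteristic functions at `C⁻¹ v`. By
`IsSolutionSDE.charFun_map`, the characteristic function of `X^x_t` at `w` is that of the Dirac mass
at `x`, evaluated at `exp (t Aᵀ) w`, times a damping factor `exp (-q/2)` independent of `x`, where
`q = ∫ ‖Bᵀ ψ‖²` along the adjoint flow `ψ`. The Lyapunov inequality makes this damping pay for
replacing the weight at `v` by the weight at `L v`, with `L = C exp (t Aᵀ) C⁻¹`. The substitution `v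
↦ L v` then costs `1 / det L = exp (-t Tr A)`, whose square root is `M`. -/

/-! ### Determinant of a matrix exponential. -/

/-- In the Leibniz expansion a non-identity permutation moves at least two points. After one factor
is differentiated, another off-diagonal factor remains, and it vanishes at the identity matrix. -/
theorem hasDerivAt_det_of_eq_one {ι : Type*} [Fintype ι] [DecidableEq ι]
    {M : ℝ → Matrix ι ι ℝ} {M' : Matrix ι ι ℝ} {s : ℝ} (h1 : M s = 1)
    (h : ∀ i j, HasDerivAt (fun u => M u i j) (M' i j) s) :
    HasDerivAt (fun u => (M u).det) M'.trace s := by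
  have h2 : HasDerivAt (fun u => ∑ σ : Equiv.Perm ι, ((Equiv.Perm.sign σ : ℤ) : ℝ) *
      ∏ i, M u (σ i) i) (∑ σ : Equiv.Perm ι, ((Equiv.Perm.sign σ : ℤ) : ℝ) *
      ∑ i, (∏ j ∈ Finset.univ.erase i, M s (σ j) j) • M' (σ i) i) s := by
    refine HasDerivAt.fun_sum fun σ _ => HasDerivAt.const_mul _ ?_
    exact HasDerivAt.fun_finsetProd fun i _ => h (σ i) i
  have h3 : (∑ σ : Equiv.Perm ι, ((Equiv.Perm.sign σ : ℤ) : ℝ) *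
      ∑ i, (∏ j ∈ Finset.univ.erase i, M s (σ j) j) • M' (σ i) i) = M'.trace := by
    rw [Finset.sum_eq_single 1]
    · simp only [h1, Equiv.Perm.sign_one, Units.val_one, Int.cast_one, one_mul, Matrix.trace,
        Equiv.Perm.one_apply, Matrix.diag_apply, Matrix.one_apply_eq, Finset.prod_const_one,
        one_smul]
    · intro σ _ hσ
      rw [Finset.sum_eq_zero, mul_zero]
      intro i _
      obtain ⟨j, hji, hj⟩ : ∃ j, j ≠ i ∧ σ j ≠ j := by
        by_contra! hcon
        refine hσ (Equiv.ext fun k => ?_)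
        by_cases hk : k = i
        · by_contra hne
          have h4 := hcon (σ k) (by rw [← hk]; exact hne)
          exact hne (σ.injective h4)
        · exact hcon k hk
      rw [Finset.prod_eq_zero (Finset.mem_erase.2 ⟨hji, Finset.mem_univ j⟩), zero_smul]
      rw [h1, Matrix.one_apply_ne hj]
    · simp
  rw [h3] at h2
  simpa only [Matrix.det_apply'] using h2

/-- The determinant along the one-parameter group is multiplicative with derivative the trace at
`0`, hence solves `D' = τ D`, `D 0 = 1`. -/
theorem det_exp_smul {E : Type*} [NormedAddCommGroup E] [NormedSpace ℝ E]
    [FiniteDimensional ℝ E] (a : E →L[ℝ] E) (s : ℝ) :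
    LinearMap.det ((NormedSpace.exp (s • a) : E →L[ℝ] E) : E →ₗ[ℝ] E) =
      Real.exp (s * LinearMap.trace ℝ E (a : E →ₗ[ℝ] E)) := by
  have : CompleteSpace E := FiniteDimensional.complete ℝ E
  let _ : NormedAlgebra ℚ (E →L[ℝ] E) := .restrictScalars ℚ ℝ _
  set τ := LinearMap.trace ℝ E (a : E →ₗ[ℝ] E)
  set D : ℝ → ℝ := fun u => LinearMap.det ((NormedSpace.exp (u • a) : E →L[ℝ] E) : E →ₗ[ℝ] E)
  let B := Module.finBasis ℝ E
  have hexp : ∀ u, HasDerivAt (fun u : ℝ => NormedSpace.exp (u • a))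
      (NormedSpace.exp (u • a) * a) u := fun u => hasDerivAt_exp_smul_const a u
  have h0 : HasDerivAt D τ 0 := by
    have := hasDerivAt_det_of_eq_one (s := 0)
      (M := fun u => LinearMap.toMatrix B B ((NormedSpace.exp (u • a) : E →L[ℝ] E) : E →ₗ[ℝ] E))
      (M' := LinearMap.toMatrix B B (a : E →ₗ[ℝ] E)) (by simp [LinearMap.toMatrix_one]) ?_
    · simpa [D, τ, LinearMap.det_toMatrix, LinearMap.trace_eq_matrix_trace ℝ B] using this
    · intro i j
      have h1 := (hexp 0).clm_apply (hasDerivAt_const (0 : ℝ) (B j))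
      have h2 := (LinearMap.toContinuousLinearMap (B.coord i)).hasFDerivAt.comp_hasDerivAt _ h1
      simpa [LinearMap.toMatrix_apply, Function.comp_def] using h2
  have hmul : ∀ u v, D (u + v) = D u * D v := by
    intro u v
    simp only [D]
    rw [add_smul, NormedSpace.exp_add_of_commute ((Commute.refl a).smul_left u |>.smul_right v),
      ← LinearMap.det_comp]
    rfl
  have hD : ∀ u, HasDerivAt D (D u * τ) u := by
    intro u
    have h1 : HasDerivAt (fun v => D (v - u)) τ u := by
      have := HasDerivAt.comp_sub_const u u (f := D) (f' := τ) (by simpa using h0)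
      exact this
    have h2 := h1.const_mul (D u)
    refine h2.congr_of_eventuallyEq (Filter.Eventually.of_forall fun v => ?_)
    simp only [← hmul]
    congr 1; ring
  have hconst : ∀ u v, D u * Real.exp (-(u * τ)) = D v * Real.exp (-(v * τ)) := by
    refine is_const_of_deriv_eq_zero (f := fun u => D u * Real.exp (-(u * τ))) ?_ ?_
    · intro u
      exact ((hD u).mul (((hasDerivAt_id u).mul_const τ).neg.exp)).differentiableAt
    · intro u
      refine (((hD u).mul (((hasDerivAt_id u).mul_const τ).neg.exp)).deriv).trans ?_
      simp; ring
  have h1 := hconst s 0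
  have h2 : D 0 = 1 := by simp [D]
  rw [h2, Real.exp_neg] at h1
  simp only [zero_mul, neg_zero, Real.exp_zero, mul_one] at h1
  exact (mul_inv_eq_one₀ (Real.exp_pos _).ne').1 h1

/-! ### Characteristic functions of sums of Brownian increments. -/

theorem integral_cexp_sum_of_iIndepFun {Ω : Type*} [MeasurableSpace Ω] {P : Measure Ω}
    {ι : Type*} [Fintype ι] {Y : ι → Ω → ℝ} (hm : ∀ i, AEMeasurable (Y i) P)
    (hY : iIndepFun Y P) :
    ∫ ω, Complex.exp ((∑ i, Y i ω : ℝ) * Complex.I) ∂P =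
      ∏ i, ∫ ω, Complex.exp (Y i ω * Complex.I) ∂P := by
  have h := congrFun (hY.charFun_map_fun_sum_eq_prod hm) 1
  rw [Finset.prod_apply, charFun_apply_real, integral_map (by fun_prop) (by fun_prop)] at h
  simp only [Complex.ofReal_one, one_mul] at h
  rw [h]
  refine Finset.prod_congr rfl fun i _ => ?_
  rw [charFun_apply_real, integral_map (hm i) (by fun_prop)]
  simp

theorem ProbabilityTheory.IsBrownianReal.integral_cexp_sum_increments {Ω : Type*} [MeasurableSpace Ω]
    {P : Measure Ω} {W : ℝ≥0 → Ω → ℝ} (hW : IsBrownianReal W P) {p : ℕ → ℝ≥0}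
    (hp : Monotone p) (n : ℕ) (β : ℕ → ℝ) :
    ∫ ω, Complex.exp ((∑ k ∈ Finset.range n, β k * (W (p (k + 1)) ω - W (p k) ω) : ℝ) *
      Complex.I) ∂P =
      Complex.exp (-(∑ k ∈ Finset.range n, β k ^ 2 * (p (k + 1) - p k : ℝ) : ℝ) / 2) := by
  have hind : iIndepFun (fun (k : Fin n) ω => β k * (W (p (k + 1)) ω - W (p k) ω)) P :=
    ((hW.hasIndepIncrements.nat hp).precomp (g := fun k : Fin n => (k : ℕ))
      Fin.val_injective).comp (fun k x => β k * x) (fun k => by fun_prop)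
  have hm : ∀ k : Fin n, AEMeasurable (fun ω => β k * (W (p (k + 1)) ω - W (p k) ω)) P :=
    fun k => ((hW.aemeasurable _).sub (hW.aemeasurable _)).const_mul _
  have h := integral_cexp_sum_of_iIndepFun hm hind
  simp only [Finset.sum_range]
  rw [h, Complex.ofReal_sum, ← Finset.sum_neg_distrib, Finset.sum_div, Complex.exp_sum]
  refine Finset.prod_congr rfl fun k _ => ?_
  have hl := hW.hasLaw_sub (p (k + 1)) (p k)
  have h2 := congrFun (congrArg charFun hl.map_eq) (β k)
  rw [charFun_gaussianReal, charFun_apply_real, integral_map hl.aemeasurable (by fun_prop)] at h2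
  simp only [Pi.sub_apply] at h2
  push_cast at h2 ⊢
  rw [h2]
  congr 1
  have h3 : dist (p (k + 1)).1 (p k).1 = p (k + 1) - p k := by
    rw [Real.dist_eq]
    exact abs_of_nonneg (sub_nonneg.2 (hp (Nat.le_succ _)))
  have h4 : ((dist (p (k + 1)).1 (p k).1 : ℝ) : ℂ) = p (k + 1) - p k := by
    rw [h3]; push_cast; rfl
  rw [h4]
  ring

/-- Independence of whole coordinate paths splits the expectation over coordinates; independent
increments then handle each coordinate. -/
theorem IsBrownianVec.integral_cexp_sum_increments {Ω : Type*} [MeasurableSpace Ω]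
    {P : Measure Ω} {m : ℕ} {W : ℝ≥0 → Ω → EuclideanSpace ℝ (Fin m)} (hW : IsBrownianVec W P)
    {p : ℕ → ℝ≥0} (hp : Monotone p) (n : ℕ) (β : ℕ → EuclideanSpace ℝ (Fin m)) :
    ∫ ω, Complex.exp ((∑ k ∈ Finset.range n, inner ℝ (β k) (W (p (k + 1)) ω - W (p k) ω) : ℝ) *
      Complex.I) ∂P =
      Complex.exp (-(∑ k ∈ Finset.range n, ‖β k‖ ^ 2 * (p (k + 1) - p k : ℝ) : ℝ) / 2) := by
  have hind := hW.indep.comp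
    (fun i x => ∑ k ∈ Finset.range n, β k i * (x (p (k + 1)) - x (p k))) (fun i => by fun_prop)
  have hm : ∀ i, AEMeasurable ((fun (x : ℝ≥0 → ℝ) =>
      ∑ k ∈ Finset.range n, β k i * (x (p (k + 1)) - x (p k))) ∘ fun ω t => W t ω i) P := by
    intro i
    have := hW.measurable
    refine Measurable.aemeasurable ?_
    simp only [Function.comp_def]
    fun_prop
  have h := integral_cexp_sum_of_iIndepFun hm hind
  simp only [Function.comp_apply] at h
  have h1 : ∀ ω, ∑ k ∈ Finset.range n, inner ℝ (β k) (W (p (k + 1)) ω - W (p k) ω) =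
      ∑ i, ∑ k ∈ Finset.range n, β k i * (W (p (k + 1)) ω i - W (p k) ω i) := by
    intro ω
    rw [Finset.sum_comm]
    refine Finset.sum_congr rfl fun k _ => ?_
    simp [PiLp.inner_apply, mul_comm]
  simp only [h1, h]
  rw [Finset.prod_congr rfl fun i _ => (hW.brownian i).integral_cexp_sum_increments hp n
    (fun k => β k i), ← Complex.exp_sum, ← Finset.sum_div, Finset.sum_neg_distrib,
    ← Complex.ofReal_sum, Finset.sum_comm]
  simp only [EuclideanSpace.real_norm_sq_eq, Finset.sum_mul]

/-! ### Convergence of Riemann sums on uniform partitions. -/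

/-- Uniform continuity on the square `[0, t]²`: within a cell both arguments of `G` move by at most
the mesh. It serves both the Riemann sums and the summation by parts below. -/
theorem tendsto_sum_integral_sub_zero {G : ℝ → ℝ → ℝ} (hG : Continuous (Function.uncurry G))
    {t : ℝ} (ht : 0 ≤ t) :
    Filter.Tendsto (fun n : ℕ => ∑ k ∈ Finset.range n,
      ∫ s in (t * k / n)..(t * (k + 1 : ℕ) / n), (G (t * k / n) s - G s (t * (k + 1 : ℕ) / n)))
      Filter.atTop (nhds 0) := by
  have hu := (isCompact_Icc (a := (0 : ℝ)) (b := t)).prod (isCompact_Icc (a := (0 : ℝ)) (b := t))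
    |>.uniformContinuousOn_of_continuous hG.continuousOn
  rw [Metric.uniformContinuousOn_iff] at hu
  rw [Metric.tendsto_atTop]
  intro ε hε
  -- Dividing by `t + 1` rather than `t` covers `t = 0` and leaves the final bound `ε t / (t + 1)`
  -- strictly below `ε`.
  obtain ⟨δ, hδ, hu⟩ := hu (ε / (t + 1)) (by positivity)
  obtain ⟨N, hN⟩ := exists_nat_gt (t / δ)
  refine ⟨N + 1, fun n hn => ?_⟩
  have hn0 : (0 : ℝ) < n := by exact_mod_cast (by omega : 0 < n)
  have hmesh : t / n < δ := by
    have : (N : ℝ) ≤ n := by exact_mod_cast (by omega : N ≤ n)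
    rw [div_lt_iff₀ hδ] at hN
    rw [div_lt_iff₀ hn0]
    nlinarith
  have hbound : ∀ k ∈ Finset.range n, ‖∫ s in (t * k / n)..(t * (k + 1 : ℕ) / n),
      (G (t * k / n) s - G s (t * (k + 1 : ℕ) / n))‖ ≤ ε / (t + 1) * (t / n) := by
    intro k hk
    have hk : ((k + 1 : ℕ) : ℝ) ≤ n := by exact_mod_cast Finset.mem_range.1 hk
    have hlen : t * (k + 1 : ℕ) / n - t * k / n = t / n := by push_cast; ring
    have hle : t * k / n ≤ t * (k + 1 : ℕ) / n := by
      rw [← sub_nonneg, hlen]; positivity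
    have h0 : 0 ≤ t * k / n := by positivity
    have h1 : t * (k + 1 : ℕ) / n ≤ t := by
      rw [div_le_iff₀ hn0]; exact mul_le_mul_of_nonneg_left hk ht
    rw [← hlen, ← abs_of_nonneg (sub_nonneg.2 hle)]
    refine intervalIntegral.norm_integral_le_of_norm_le_const fun s hs => ?_
    rw [Set.uIoc_of_le hle] at hs
    rw [← dist_eq_norm]
    refine (hu (t * k / n, s) ⟨⟨h0, hle.trans h1⟩, ⟨h0.trans hs.1.le, hs.2.trans h1⟩⟩
      (s, t * (k + 1 : ℕ) / n) ⟨⟨h0.trans hs.1.le, hs.2.trans h1⟩, ⟨h0.trans hle, h1⟩⟩ ?_).le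
    rw [Prod.dist_eq, max_lt_iff, dist_comm, Real.dist_eq, dist_comm, Real.dist_eq,
      abs_of_nonneg (by linarith [hs.1]), abs_of_nonneg (by linarith [hs.2])]
    constructor <;> linarith [hs.1, hs.2]
  rw [dist_zero_right]
  refine (norm_sum_le_of_le _ hbound).trans_lt ?_
  rw [Finset.sum_const, Finset.card_range, nsmul_eq_mul]
  have : (n : ℝ) * (ε / (t + 1) * (t / n)) = ε * (t / (t + 1)) := by field_simp
  rw [this]
  have h2 : t / (t + 1) < 1 := by rw [div_lt_one (by positivity)]; linarith
  nlinarith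

theorem tendsto_sum_mul_integral {g : ℝ → ℝ} (hg : Continuous g) {t : ℝ} (ht : 0 ≤ t) :
    Filter.Tendsto (fun n : ℕ => ∑ k ∈ Finset.range n,
      g (t * k / n) * (t * (k + 1 : ℕ) / n - t * k / n))
      Filter.atTop (nhds (∫ s in (0 : ℝ)..t, g s)) := by
  have h := (tendsto_sum_integral_sub_zero (G := fun u _ => g u)
    (hg.comp continuous_fst) ht).add_const (∫ s in (0 : ℝ)..t, g s)
  rw [zero_add] at h
  refine h.congr' ?_
  filter_upwards [Filter.eventually_gt_atTop 0] with n hn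
  have hn : (n : ℝ) ≠ 0 := by positivity
  have hadj := intervalIntegral.sum_integral_adjacent_intervals (f := g) (μ := volume)
    (a := fun k : ℕ => t * k / n) (n := n) fun k _ => hg.intervalIntegrable _ _
  have e1 : t * ((0 : ℕ) : ℝ) / n = 0 := by simp
  have e2 : t * (n : ℝ) / n = t := by field_simp
  simp only [e1, e2] at hadj
  rw [← hadj, ← Finset.sum_add_distrib]
  refine Finset.sum_congr rfl fun k _ => ?_
  rw [intervalIntegral.integral_sub intervalIntegrable_const (hg.intervalIntegrable _ _),
    intervalIntegral.integral_const, smul_eq_mul]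
  ring

/-! ### Adjoint flow and pathwise summation by parts. -/

section LinearFlow

variable {E : Type*} [NormedAddCommGroup E] [InnerProductSpace ℝ E] [CompleteSpace E]

/-- The backward flow `s ↦ exp ((t - s) a†) w` of the adjoint equation. -/
def adjointFlow (a : E →L[ℝ] E) (w : E) (t s : ℝ) : E :=
  NormedSpace.exp ((t - s) • ContinuousLinearMap.adjoint a) w

theorem adjointFlow_self (a : E →L[ℝ] E) (w : E) (t : ℝ) : adjointFlow a w t t = w := by
  simp [adjointFlow]

theorem hasDerivAt_adjointFlow (a : E →L[ℝ] E) (w : E) (t s : ℝ) :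
    HasDerivAt (adjointFlow a w t)
      (-(ContinuousLinearMap.adjoint a (adjointFlow a w t s))) s := by
  have h := (hasDerivAt_exp_smul_const' (ContinuousLinearMap.adjoint a) (t - s)).clm_apply
    (hasDerivAt_const (t - s) w)
  have h2 := h.scomp s ((hasDerivAt_id s).const_sub t)
  change HasDerivAt (fun x => NormedSpace.exp ((t - x) • ContinuousLinearMap.adjoint a) w) _ s
  simpa [adjointFlow, Function.comp_def] using h2

theorem continuous_adjointFlow (a : E →L[ℝ] E) (w : E) (t : ℝ) :
    Continuous (adjointFlow a w t) :=
  continuous_iff_continuousAt.2 fun s => (hasDerivAt_adjointFlow a w t s).continuousAt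

/-- Itô-type sums of the backward flow against the forcing of a linear integral equation. -/
theorem tendsto_sum_inner_adjointFlow (a : E →L[ℝ] E) (w : E) {t : ℝ} (ht : 0 ≤ t)
    {x ν : ℝ → E} {x₀ : E} (hx : Continuous x)
    (h : ∀ s, 0 ≤ s → x s = x₀ + (∫ u in (0 : ℝ)..s, a (x u)) + ν s) :
    Filter.Tendsto (fun n : ℕ => ∑ k ∈ Finset.range n,
      inner ℝ (adjointFlow a w t (t * k / n)) (ν (t * (k + 1 : ℕ) / n) - ν (t * k / n)))
      Filter.atTop (nhds (inner ℝ w (x t) - inner ℝ (adjointFlow a w t 0) (x 0))) := by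
  set ψ := adjointFlow a w t with hψ
  have hψc : Continuous ψ := continuous_adjointFlow a w t
  set a' := ContinuousLinearMap.adjoint a with ha'
  have hax : Continuous fun u => a (x u) := a.continuous.comp hx
  have haψ : Continuous fun u => a' (ψ u) := a'.continuous.comp hψc
  -- No stochastic integral is needed: the sums equal the telescoped boundary term minus the sum of
  -- `∫ (G p s - G s q)` over cells `[p, q]`, which tends to `0`.
  have hlim := (tendsto_sum_integral_sub_zero (G := fun u v => inner ℝ (a' (ψ u)) (x v))
    ((haψ.comp continuous_fst).inner (hx.comp continuous_snd)) ht).const_sub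
    (inner ℝ w (x t) - inner ℝ (ψ 0) (x 0))
  rw [sub_zero] at hlim
  refine hlim.congr' ?_
  filter_upwards [Filter.eventually_gt_atTop 0] with n hn
  have hn : (n : ℝ) ≠ 0 := by positivity
  have htel := Finset.sum_range_sub (fun k : ℕ => inner ℝ (ψ (t * k / n)) (x (t * k / n))) n
  have e1 : t * ((0 : ℕ) : ℝ) / n = 0 := by simp
  have e2 : t * (n : ℝ) / n = t := by field_simp
  simp only [e1, e2] at htel
  rw [show ψ t = w from adjointFlow_self a w t] at htel
  rw [← htel, ← Finset.sum_sub_distrib]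
  refine Finset.sum_congr rfl fun k _ => ?_
  have hp0 : 0 ≤ t * (k : ℝ) / n := by positivity
  have hp1 : 0 ≤ t * ((k + 1 : ℕ) : ℝ) / n := by positivity
  generalize t * (k : ℝ) / n = p at *
  generalize t * ((k + 1 : ℕ) : ℝ) / n = q at *
  have hν : ν q - ν p = x q - x p - ∫ u in p..q, a (x u) := by
    have hadd := intervalIntegral.integral_add_adjacent_intervals (μ := volume)
      (a := 0) (b := p) (c := q) (hax.intervalIntegrable _ _) (hax.intervalIntegrable _ _)
    rw [h q hp1, h p hp0, ← hadd]
    abel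
  have hi1 : ∫ s in p..q, inner ℝ (a' (ψ p)) (x s) = inner ℝ (ψ p) (∫ u in p..q, a (x u)) := by
    have := (innerSL ℝ (ψ p)).intervalIntegral_comp_comm (μ := volume)
      (hax.intervalIntegrable p q)
    simp only [innerSL_apply_apply] at this
    rw [← this]
    simp only [ha', ContinuousLinearMap.adjoint_inner_left]
  have hi2 : ∫ s in p..q, inner ℝ (a' (ψ s)) (x q) = inner ℝ (ψ p - ψ q) (x q) := by
    have hd : ∀ s ∈ Set.uIcc p q, HasDerivAt (fun s => - inner ℝ (ψ s) (x q))
        (inner ℝ (a' (ψ s)) (x q)) s := by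
      intro s _
      have := ((hasDerivAt_adjointFlow a w t s).inner ℝ (hasDerivAt_const s (x q))).fun_neg
      simpa [inner_neg_left] using this
    rw [intervalIntegral.integral_eq_sub_of_hasDerivAt hd
      ((haψ.inner continuous_const).intervalIntegrable _ _), inner_sub_left]
    ring
  rw [intervalIntegral.integral_sub ((continuous_const.inner hx).intervalIntegrable _ _)
    ((haψ.inner continuous_const).intervalIntegrable _ _), hi1, hi2, hν]
  simp only [inner_sub_left, inner_sub_right]
  ring

end LinearFlow


/-! ### Law of the solution and the Lyapunov estimate. -/

theorem IsBrownianVec.ae_eval_zero {Ω : Type*} [MeasurableSpace Ω] {P : Measure Ω} {m : ℕ}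
    {W : ℝ≥0 → Ω → EuclideanSpace ℝ (Fin m)} (hW : IsBrownianVec W P) :
    ∀ᵐ ω ∂P, W 0 ω = 0 := by
  filter_upwards [ae_all_iff.2 fun i => (hW.brownian i).eval_zero_ae_eq_zero] with ω hω
  ext i
  exact hω i

/-- The sums `U n` converge almost surely to `⟪w, X t⟫ - ⟪ψ 0, x⟫`, while their characteristic
functions are explicit Gaussians with convergent variances. Comparing the two limits gives the
formula. -/
theorem IsSolutionSDE.charFun_map {Ω : Type*} [MeasurableSpace Ω] {P : Measure Ω}
    [IsProbabilityMeasure P] {d m : ℕ} {A : Matrix (Fin d) (Fin d) ℝ}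
    {B : Matrix (Fin d) (Fin m) ℝ} {W : ℝ≥0 → Ω → EuclideanSpace ℝ (Fin m)}
    (hW : IsBrownianVec W P) {x : EuclideanSpace ℝ (Fin d)}
    {X : ℝ≥0 → Ω → EuclideanSpace ℝ (Fin d)} (hX : IsSolutionSDE A B W P x X)
    {a : EuclideanSpace ℝ (Fin d) →L[ℝ] EuclideanSpace ℝ (Fin d)}
    (ha : ∀ v, a v = Matrix.toEuclideanLin A v)
    {b : EuclideanSpace ℝ (Fin m) →L[ℝ] EuclideanSpace ℝ (Fin d)}
    (hb : ∀ v, b v = Matrix.toEuclideanLin B v) (t : ℝ≥0) (w : EuclideanSpace ℝ (Fin d)) :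
    charFun (P.map (X t)) w = Complex.exp ((inner ℝ (adjointFlow a w t 0) x : ℝ) * Complex.I) *
      Complex.exp (-((∫ s in (0 : ℝ)..t,
        ‖ContinuousLinearMap.adjoint b (adjointFlow a w t s)‖ ^ 2 : ℝ) : ℂ) / 2) := by
  set ψ := adjointFlow a w t with hψ
  set b' := ContinuousLinearMap.adjoint b with hb'
  set p : ℕ → ℕ → ℝ≥0 := fun n k => t * k / n with hp
  have hpc : ∀ n k : ℕ, (p n k : ℝ) = t * k / n := fun n k => by simp [hp]
  have hpm : ∀ n, Monotone (p n) := fun n i j hij => by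
    simp only [hp]
    gcongr
  set U : ℕ → Ω → ℝ := fun n ω => ∑ k ∈ Finset.range n,
    inner ℝ (b' (ψ (p n k))) (W (p n (k + 1)) ω - W (p n k) ω) with hU
  have hWm := hW.measurable
  have hUm : ∀ n, Measurable (U n) := fun n => by
    simp only [hU]
    fun_prop
  have hlim : ∀ᵐ ω ∂P, Filter.Tendsto (fun n => U n ω) Filter.atTop
      (nhds (inner ℝ w (X t ω) - inner ℝ (ψ 0) x)) := by
    filter_upwards [hX.cont, hX.eqn, hW.ae_eval_zero] with ω hc he h0
    -- The initial condition comes from the integral equation at time `0` and `W 0 = 0` almost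
    -- surely.
    have hx0 : X 0 ω = x := by simpa [h0] using he 0
    have h := tendsto_sum_inner_adjointFlow a w t.coe_nonneg
      (x := fun s => X s.toNNReal ω) (ν := fun s => b (W s.toNNReal ω)) (x₀ := x)
      (hc.comp continuous_real_toNNReal) (fun s hs => by
        have := he s.toNNReal
        rw [Real.coe_toNNReal s hs] at this
        simpa only [ha, hb] using this)
    simp only [Real.toNNReal_coe, Real.toNNReal_zero, hx0, ← hpc, ← map_sub] at h
    refine h.congr fun n => Finset.sum_congr rfl fun k _ => ?_
    rw [hb', ContinuousLinearMap.adjoint_inner_left]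
  have h1 : Filter.Tendsto (fun n => ∫ ω, Complex.exp (U n ω * Complex.I) ∂P) Filter.atTop
      (nhds (∫ ω, Complex.exp ((inner ℝ w (X t ω) - inner ℝ (ψ 0) x : ℝ) * Complex.I) ∂P)) := by
    refine tendsto_integral_of_dominated_convergence (fun _ => 1) (fun n => ?_)
      (integrable_const _) (fun n => ?_) ?_
    · have := hUm n
      exact Measurable.aestronglyMeasurable (by fun_prop)
    · exact Filter.Eventually.of_forall fun ω => (Complex.norm_exp_ofReal_mul_I _).le
    · filter_upwards [hlim] with ω hω
      exact ((Complex.continuous_exp.comp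
        (Complex.continuous_ofReal.mul continuous_const)).tendsto _).comp hω
  have hψc : Continuous fun s => ‖b' (ψ s)‖ ^ 2 :=
    (b'.continuous.comp (continuous_adjointFlow a w t)).norm.pow 2
  have h2 : Filter.Tendsto (fun n => ∫ ω, Complex.exp (U n ω * Complex.I) ∂P) Filter.atTop
      (nhds (Complex.exp (-((∫ s in (0 : ℝ)..t, ‖b' (ψ s)‖ ^ 2 : ℝ) : ℂ) / 2))) := by
    have h3 := ((Complex.continuous_exp.comp
      ((Complex.continuous_ofReal.neg).div_const 2)).tendsto _).comp
      (tendsto_sum_mul_integral hψc t.coe_nonneg)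
    refine h3.congr fun n => ?_
    simp only [hU]
    rw [hW.integral_cexp_sum_increments (hpm n) n fun k => b' (ψ (p n k))]
    simp only [Function.comp_apply, Pi.neg_apply, hpc]
  have h4 := tendsto_nhds_unique h1 h2
  rw [charFun_apply, integral_map (hX.measurable t).aemeasurable (by fun_prop), ← h4,
    ← integral_const_mul]
  refine integral_congr_ae (Filter.Eventually.of_forall fun ω => ?_)
  simp only [← Complex.exp_add]
  rw [real_inner_comm]
  push_cast
  congr 1
  ring

/-- Along the flow, `-‖c ψ‖²/2` has derivative `⟪c a† ψ, c ψ⟫`, which `h` bounds by `‖b† ψ‖²`;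
integrate over `[0, t]`. -/
theorem norm_adjointFlow_le {E F : Type*} [NormedAddCommGroup E] [InnerProductSpace ℝ E]
    [CompleteSpace E] [NormedAddCommGroup F] [InnerProductSpace ℝ F] [CompleteSpace F]
    {a c : E →L[ℝ] E} {b : F →L[ℝ] E}
    (h : ∀ w, inner ℝ (c (ContinuousLinearMap.adjoint a w)) (c w) ≤
      ‖ContinuousLinearMap.adjoint b w‖ ^ 2) (w : E) {t : ℝ} (ht : 0 ≤ t) :
    (‖c (adjointFlow a w t 0)‖ ^ 2 - ‖c w‖ ^ 2) / 2 ≤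
      ∫ s in (0 : ℝ)..t, ‖ContinuousLinearMap.adjoint b (adjointFlow a w t s)‖ ^ 2 := by
  have hψ := continuous_adjointFlow a w t
  have hd : ∀ s, HasDerivAt (fun s => -(‖c (adjointFlow a w t s)‖ ^ 2 / 2))
      (inner ℝ (c (ContinuousLinearMap.adjoint a (adjointFlow a w t s)))
        (c (adjointFlow a w t s))) s := by
    intro s
    have h1 := (((c.hasFDerivAt.comp_hasDerivAt s
      (hasDerivAt_adjointFlow a w t s)).norm_sq).div_const 2).fun_neg
    convert! h1 using 1
    rw [Function.comp_apply, map_neg, inner_neg_right, real_inner_comm]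
    ring
  have hc : Continuous fun s => inner ℝ (c (ContinuousLinearMap.adjoint a (adjointFlow a w t s)))
      (c (adjointFlow a w t s)) := by fun_prop
  have hi := intervalIntegral.integral_eq_sub_of_hasDerivAt (fun s _ => hd s)
    (hc.intervalIntegrable 0 t)
  rw [adjointFlow_self] at hi
  refine le_trans (le_of_eq ?_) (intervalIntegral.integral_mono_on ht (hc.intervalIntegrable 0 t)
    (Continuous.intervalIntegrable (by fun_prop) _ _) fun s _ => h (adjointFlow a w t s))
  rw [hi]
  ring

/-! ### Functionals on the span of the representers. -/

/-- A function is given by an element of norm at most `M` of a real Hilbert space as soon as it is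
bounded by `M` as a functional on the span of the representers. -/
theorem exists_inner_eq_of_bound {X H : Type*} [NormedAddCommGroup H] [InnerProductSpace ℝ H]
    [CompleteSpace H] (K : X → H) (g : X → ℝ) {M : ℝ} (hM : 0 ≤ M)
    (h : ∀ α : X →₀ ℝ, |α.sum fun x r => r * g x| ≤ M * ‖α.sum fun x r => r • K x‖) :
    ∃ y : H, (∀ x, inner ℝ (K x) y = g x) ∧ ‖y‖ ≤ M := by
  let T : (X →₀ ℝ) →ₗ[ℝ] H := Finsupp.linearCombination ℝ K
  let G : (X →₀ ℝ) →ₗ[ℝ] ℝ := Finsupp.linearCombination ℝ g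
  have hTG : ∀ α, |G α| ≤ M * ‖T α‖ := h
  -- The bound makes `G` factor through the range of `T`; Hahn–Banach extends it without increasing
  -- the norm and Riesz represents it.
  have hker : LinearMap.ker T ≤ LinearMap.ker G := by
    intro α hα
    rw [LinearMap.mem_ker] at hα ⊢
    have := hTG α
    rw [hα, norm_zero, mul_zero] at this
    exact abs_nonpos_iff.1 this
  let φ : LinearMap.range T →ₗ[ℝ] ℝ :=
    (LinearMap.ker T).liftQ G hker ∘ₗ (T.quotKerEquivRange.symm : _ →ₗ[ℝ] _)
  have hφ : ∀ α, φ ⟨T α, α, rfl⟩ = G α := by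
    intro α
    have : T.quotKerEquivRange.symm ⟨T α, α, rfl⟩ = (LinearMap.ker T).mkQ α :=
      T.quotKerEquivRange_symm_apply_image α ⟨α, rfl⟩
    simp only [φ, LinearMap.comp_apply, LinearEquiv.coe_coe, this]
    simp
  have hφb : ∀ z, ‖φ z‖ ≤ M * ‖z‖ := by
    rintro ⟨_, α, rfl⟩
    rw [hφ]
    exact hTG α
  obtain ⟨L, hL, hLn⟩ := exists_extension_norm_eq (LinearMap.range T) (φ.mkContinuous M hφb)
  refine ⟨(InnerProductSpace.toDual ℝ H).symm L, fun x => ?_, ?_⟩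
  · rw [real_inner_comm, InnerProductSpace.toDual_symm_apply]
    have h1 : T (Finsupp.single x 1) = K x := by simp [T]
    have h2 := hL ⟨T (Finsupp.single x 1), _, rfl⟩
    rw [LinearMap.mkContinuous_apply, hφ] at h2
    simpa [h1, G] using h2
  · rw [LinearIsometryEquiv.norm_map, hLn]
    exact LinearMap.mkContinuous_norm_le _ hM _

/-! ### Kernel mean embeddings. -/

section MeanEmbedding

variable {d : ℕ} {C : Matrix (Fin d) (Fin d) ℝ}

/-- The kernel function `y ↦ k^C(y, x)` as an element of `ℍ_C`. -/
def gaussianFeature (C : Matrix (Fin d) (Fin d) ℝ) (x : EuclideanSpace ℝ (Fin d)) :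
    GaussianRKHS C :=
  RKHS.kerFun (GaussianRKHS C) x (1 : ℝ)

theorem inner_gaussianFeature_left (x : EuclideanSpace ℝ (Fin d)) (f : GaussianRKHS C) :
    inner ℝ (gaussianFeature C x) f = f x := by
  simp [gaussianFeature, RKHS.kerFun_inner]

theorem inner_gaussianFeature (x y : EuclideanSpace ℝ (Fin d)) :
    inner ℝ (gaussianFeature C x) (gaussianFeature C y) = gaussianKernel C x y := by
  rw [inner_gaussianFeature_left, gaussianFeature, RKHS.kerFun_apply, RKHS.OfKernel.kernel_ofKernel]
  simp [gaussianKernelMatrix]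

theorem norm_gaussianFeature (x : EuclideanSpace ℝ (Fin d)) : ‖gaussianFeature C x‖ = 1 := by
  have h := real_inner_self_eq_norm_sq (gaussianFeature C x)
  rw [inner_gaussianFeature] at h
  simp only [gaussianKernel, sub_self, map_zero, norm_zero] at h
  norm_num at h
  exact (pow_eq_one_iff_of_nonneg (norm_nonneg _) two_ne_zero).1 h.symm

theorem continuous_gaussianKernel :
    Continuous fun z : EuclideanSpace ℝ (Fin d) × EuclideanSpace ℝ (Fin d) =>
      gaussianKernel C z.1 z.2 := by
  have := LinearMap.continuous_of_finiteDimensional (Matrix.toEuclideanLin C⁻¹)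
  unfold gaussianKernel
  fun_prop

/-- The features are unit vectors, so `‖k_y - k_x‖² = 2 - 2 k(y, x)`. Continuity and boundedness
make them Bochner integrable. -/
theorem continuous_gaussianFeature : Continuous (gaussianFeature C) := by
  rw [continuous_iff_continuousAt]
  intro x
  rw [ContinuousAt, tendsto_iff_norm_sub_tendsto_zero]
  have h : ∀ y, ‖gaussianFeature C y - gaussianFeature C x‖ =
      Real.sqrt (2 - 2 * gaussianKernel C y x) := by
    intro y
    rw [← Real.sqrt_sq (norm_nonneg (gaussianFeature C y - gaussianFeature C x)),
      norm_sub_sq_real, norm_gaussianFeature, norm_gaussianFeature, inner_gaussianFeature]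
    congr 1; ring
  simp only [h]
  have hc : Continuous fun y => Real.sqrt (2 - 2 * gaussianKernel C y x) :=
    (continuous_const.sub (continuous_const.mul (continuous_gaussianKernel.comp
      (continuous_id.prodMk continuous_const)))).sqrt
  have := hc.tendsto x
  simpa [gaussianKernel] using this

theorem integrable_gaussianFeature (μ : Measure (EuclideanSpace ℝ (Fin d))) [IsFiniteMeasure μ] :
    Integrable (gaussianFeature C) μ :=
  Integrable.of_bound continuous_gaussianFeature.stronglyMeasurable.aestronglyMeasurable 1
    (Filter.Eventually.of_forall fun x => (norm_gaussianFeature x).le)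

theorem continuous_gaussianRKHS (f : GaussianRKHS C) : Continuous f := by
  have : (f : EuclideanSpace ℝ (Fin d) → ℝ) = fun x => inner ℝ (gaussianFeature C x) f :=
    funext fun x => (inner_gaussianFeature_left x f).symm
  rw [this]
  exact continuous_gaussianFeature.inner continuous_const

theorem abs_gaussianRKHS_le (f : GaussianRKHS C) (x : EuclideanSpace ℝ (Fin d)) :
    ‖f x‖ ≤ ‖f‖ := by
  rw [← inner_gaussianFeature_left]
  refine (norm_inner_le_norm _ _).trans_eq ?_
  rw [norm_gaussianFeature, one_mul]

/-- The kernel mean embedding of a measure in `ℍ_C`. -/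
def meanEmbedding (C : Matrix (Fin d) (Fin d) ℝ) (μ : Measure (EuclideanSpace ℝ (Fin d))) :
    GaussianRKHS C :=
  ∫ x, gaussianFeature C x ∂μ

theorem inner_meanEmbedding (μ : Measure (EuclideanSpace ℝ (Fin d))) [IsFiniteMeasure μ]
    (f : GaussianRKHS C) : inner ℝ f (meanEmbedding C μ) = ∫ x, f x ∂μ := by
  rw [meanEmbedding, ← integral_inner (integrable_gaussianFeature μ)]
  refine integral_congr_ae (Filter.Eventually.of_forall fun x => ?_)
  rw [← inner_gaussianFeature_left, real_inner_comm]

theorem inner_meanEmbedding_meanEmbedding (μ ν : Measure (EuclideanSpace ℝ (Fin d)))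
    [IsFiniteMeasure μ] [IsFiniteMeasure ν] :
    inner ℝ (meanEmbedding C μ) (meanEmbedding C ν) =
      ∫ z, gaussianKernel C z.1 z.2 ∂(μ.prod ν) := by
  have hint : Integrable (fun z : EuclideanSpace ℝ (Fin d) × EuclideanSpace ℝ (Fin d) =>
      gaussianKernel C z.1 z.2) (μ.prod ν) := by
    refine Integrable.of_bound
      continuous_gaussianKernel.stronglyMeasurable.aestronglyMeasurable 1
      (Filter.Eventually.of_forall fun z => ?_)
    rw [gaussianKernel, Real.norm_of_nonneg (Real.exp_pos _).le, Real.exp_le_one_iff]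
    simp
  rw [integral_prod _ hint, real_inner_comm, inner_meanEmbedding]
  refine integral_congr_ae (Filter.Eventually.of_forall fun x => ?_)
  dsimp only
  rw [← inner_gaussianFeature_left, inner_meanEmbedding]
  refine integral_congr_ae (Filter.Eventually.of_forall fun y => ?_)
  rw [← inner_gaussianFeature_left, real_inner_comm, inner_gaussianFeature]

theorem meanEmbedding_dirac (x : EuclideanSpace ℝ (Fin d)) :
    meanEmbedding C (Measure.dirac x) = gaussianFeature C x :=
  integral_dirac' _ _ continuous_gaussianFeature.stronglyMeasurable

end MeanEmbedding

/-! ### Fourier representation of the RKHS norm. -/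

/-- The Gaussian weight that is the Fourier transform of the Gaussian kernel. -/
def gaussianWeight {E : Type*} [Norm E] (v : E) : ℝ := Real.exp (-(1 / 4 : ℝ) * ‖v‖ ^ 2)

theorem integrable_gaussianWeight {E : Type*} [NormedAddCommGroup E] [InnerProductSpace ℝ E]
    [FiniteDimensional ℝ E] [MeasurableSpace E] [BorelSpace E] :
    Integrable (gaussianWeight : E → ℝ) := by
  have h := (GaussianFourier.integrable_cexp_neg_mul_sq_norm_add (V := E) (b := (1 / 4 : ℂ))
    (by norm_num) 0 0).norm
  refine h.congr (Filter.Eventually.of_forall fun v => ?_)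
  have : -(1 / 4 : ℂ) * ‖v‖ ^ 2 + 0 * (inner ℝ (0 : E) v : ℝ) =
      ((-(1 / 4 : ℝ) * ‖v‖ ^ 2 : ℝ) : ℂ) := by push_cast; ring
  dsimp only
  rw [this, gaussianWeight, Complex.norm_exp, Complex.ofReal_re]

theorem integral_gaussianWeight_mul_cexp {E : Type*} [NormedAddCommGroup E]
    [InnerProductSpace ℝ E] [FiniteDimensional ℝ E] [MeasurableSpace E] [BorelSpace E] (u : E) :
    ∫ v : E, (gaussianWeight v : ℂ) * Complex.exp ((inner ℝ u v : ℝ) * Complex.I) =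
      (∫ v : E, gaussianWeight v : ℝ) * (Real.exp (-‖u‖ ^ 2) : ℂ) := by
  have h := GaussianFourier.integral_cexp_neg_mul_sq_norm_add (V := E) (b := (1 / 4 : ℂ))
    (by norm_num) Complex.I u
  have h0 := GaussianFourier.integral_cexp_neg_mul_sq_norm (V := E) (b := (1 / 4 : ℂ))
    (by norm_num)
  -- The normalising constant is kept as the total mass of the weight, since it cancels in the end.
  rw [← h0] at h
  have hw : ∀ v : E, (gaussianWeight v : ℂ) = Complex.exp (-(1 / 4 : ℂ) * ‖v‖ ^ 2) := by
    intro v; simp [gaussianWeight]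
  rw [← integral_complex_ofReal]
  simp only [hw, ← Complex.exp_add, Complex.ofReal_exp]
  convert! h using 3
  · ring_nf
  · push_cast
    rw [Complex.I_sq]; ring

theorem integral_gaussianWeight_pos {E : Type*} [NormedAddCommGroup E] [InnerProductSpace ℝ E]
    [FiniteDimensional ℝ E] [MeasurableSpace E] [BorelSpace E] :
    0 < ∫ v : E, gaussianWeight v :=
  integral_exp_pos (f := fun v : E => -(1 / 4 : ℝ) * ‖v‖ ^ 2) integrable_gaussianWeight

theorem continuous_gaussianWeight {E : Type*} [NormedAddCommGroup E] :
    Continuous (gaussianWeight : E → ℝ) := by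
  unfold gaussianWeight
  fun_prop

/-- The product is the characteristic function of the difference of independent variables with laws
`μ` and `ν`; by Fubini the weight integrates to the kernel. -/
theorem integral_gaussianWeight_mul_charFun {d : ℕ} {C : Matrix (Fin d) (Fin d) ℝ}
    {S : EuclideanSpace ℝ (Fin d) →L[ℝ] EuclideanSpace ℝ (Fin d)}
    (hS : ∀ v, S v = Matrix.toEuclideanLin C⁻¹ v) (hsym : ∀ u v, inner ℝ (S u) v = inner ℝ u (S v))
    (μ ν : Measure (EuclideanSpace ℝ (Fin d))) [IsFiniteMeasure μ] [IsFiniteMeasure ν] :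
    ∫ v, (gaussianWeight v : ℂ) * (charFun μ (S v) * starRingEnd ℂ (charFun ν (S v))) =
      (∫ v : EuclideanSpace ℝ (Fin d), gaussianWeight v : ℝ) *
        (inner ℝ (meanEmbedding C μ) (meanEmbedding C ν) : ℝ) := by
  have h1 : ∀ v, charFun μ (S v) * starRingEnd ℂ (charFun ν (S v)) =
      ∫ z, Complex.exp ((inner ℝ (S (z.1 - z.2)) v : ℝ) * Complex.I) ∂(μ.prod ν) := by
    intro v
    rw [← charFun_neg, charFun_apply, charFun_apply, ← integral_prod_mul]
    refine integral_congr_ae (Filter.Eventually.of_forall fun z => ?_)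
    simp only
    rw [← Complex.exp_add, hsym, inner_sub_left, inner_neg_right]
    congr 1
    push_cast
    ring
  have hint : Integrable (Function.uncurry
      fun (v : EuclideanSpace ℝ (Fin d)) (z : EuclideanSpace ℝ (Fin d) × EuclideanSpace ℝ (Fin d))
        => (gaussianWeight v : ℂ) * Complex.exp ((inner ℝ (S (z.1 - z.2)) v : ℝ) * Complex.I))
      (volume.prod (μ.prod ν)) := by
    have hw := (integrable_gaussianWeight (E := EuclideanSpace ℝ (Fin d))).comp_fst (μ.prod ν)
    refine hw.mono' ?_ (Filter.Eventually.of_forall fun p => ?_)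
    · have := continuous_gaussianWeight (E := EuclideanSpace ℝ (Fin d))
      refine Continuous.aestronglyMeasurable ?_
      unfold Function.uncurry
      fun_prop
    · rw [Function.uncurry, norm_mul, Complex.norm_exp_ofReal_mul_I, mul_one, Complex.norm_real,
        gaussianWeight, Real.norm_of_nonneg (Real.exp_pos _).le]
  simp only [h1, ← integral_const_mul]
  rw [integral_integral_swap hint]
  simp only [integral_gaussianWeight_mul_cexp]
  rw [integral_const_mul, inner_meanEmbedding_meanEmbedding,
    ← integral_complex_ofReal (μ := μ.prod ν)]
  simp only [gaussianKernel, hS]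

theorem integral_gaussianWeight_mul_norm_sum_charFun_sq {d : ℕ} {C : Matrix (Fin d) (Fin d) ℝ}
    {S : EuclideanSpace ℝ (Fin d) →L[ℝ] EuclideanSpace ℝ (Fin d)}
    (hS : ∀ v, S v = Matrix.toEuclideanLin C⁻¹ v) (hsym : ∀ u v, inner ℝ (S u) v = inner ℝ u (S v))
    {ι : Type*} (s : Finset ι) (r : ι → ℝ) (μ : ι → Measure (EuclideanSpace ℝ (Fin d)))
    [∀ i, IsFiniteMeasure (μ i)] :
    ∫ v, gaussianWeight v * ‖∑ i ∈ s, (r i : ℂ) * charFun (μ i) (S v)‖ ^ 2 =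
      (∫ v : EuclideanSpace ℝ (Fin d), gaussianWeight v) *
        ‖∑ i ∈ s, r i • meanEmbedding C (μ i)‖ ^ 2 := by
  apply Complex.ofReal_injective
  rw [← integral_complex_ofReal]
  have hint : ∀ i j, Integrable fun v : EuclideanSpace ℝ (Fin d) => (gaussianWeight v : ℂ) *
      (charFun (μ i) (S v) * starRingEnd ℂ (charFun (μ j) (S v))) := by
    intro i j
    refine (integrable_gaussianWeight.mul_const ((μ i).real Set.univ * (μ j).real Set.univ)).mono'
      ?_ (Filter.Eventually.of_forall fun v => ?_)
    · have := continuous_gaussianWeight (E := EuclideanSpace ℝ (Fin d))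
      have h1 := (measurable_charFun (μ := μ i)).comp S.measurable
      have h2 := (measurable_charFun (μ := μ j)).comp S.measurable
      refine Measurable.aestronglyMeasurable ?_
      refine (Complex.measurable_ofReal.comp this.measurable).mul
        (h1.mul (Complex.continuous_conj.measurable.comp h2))
    · rw [norm_mul, norm_mul, RCLike.norm_conj, Complex.norm_real, gaussianWeight,
        Real.norm_of_nonneg (Real.exp_pos _).le]
      gcongr
      · exact norm_charFun_le _
      · exact norm_charFun_le _
  have h1 : ∀ v, ((gaussianWeight v * ‖∑ i ∈ s, (r i : ℂ) * charFun (μ i) (S v)‖ ^ 2 : ℝ) : ℂ) =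
      ∑ i ∈ s, ∑ j ∈ s, ((r i * r j : ℝ) : ℂ) * ((gaussianWeight v : ℂ) *
        (charFun (μ i) (S v) * starRingEnd ℂ (charFun (μ j) (S v)))) := by
    intro v
    rw [Complex.ofReal_mul, Complex.ofReal_pow, ← Complex.mul_conj', map_sum, Finset.sum_mul_sum,
      Finset.mul_sum]
    refine Finset.sum_congr rfl fun i _ => ?_
    rw [Finset.mul_sum]
    refine Finset.sum_congr rfl fun j _ => ?_
    rw [map_mul, Complex.conj_ofReal]
    push_cast
    ring
  simp only [h1]
  rw [integral_finsetSum _ fun i _ => integrable_finsetSum _ fun j _ => (hint i j).const_mul _]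
  simp only [integral_finsetSum _ fun j _ => (hint _ j).const_mul _, integral_const_mul,
    integral_gaussianWeight_mul_charFun hS hsym]
  rw [← real_inner_self_eq_norm_sq, sum_inner, Complex.ofReal_mul, Complex.ofReal_sum,
    Finset.mul_sum]
  refine Finset.sum_congr rfl fun i _ => ?_
  rw [inner_sum, Complex.ofReal_sum, Finset.mul_sum]
  refine Finset.sum_congr rfl fun j _ => ?_
  rw [real_inner_smul_left, real_inner_smul_right]
  push_cast
  ring

/-! ### Change of variables and matrix translation. -/

theorem integral_comp_linearMap {E : Type*} [NormedAddCommGroup E] [NormedSpace ℝ E]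
    [FiniteDimensional ℝ E] [MeasurableSpace E] [BorelSpace E] (μ : Measure E)
    [μ.IsAddHaarMeasure] (L : E →L[ℝ] E) (hL : LinearMap.det (L : E →ₗ[ℝ] E) ≠ 0) {G : E → ℝ}
    (hG : Integrable G μ) :
    Integrable (fun v => G (L v)) μ ∧
      ∫ v, G (L v) ∂μ = |(LinearMap.det (L : E →ₗ[ℝ] E))⁻¹| * ∫ v, G v ∂μ := by
  have hmap : μ.map L = ENNReal.ofReal |(LinearMap.det (L : E →ₗ[ℝ] E))⁻¹| • μ :=
    Measure.map_linearMap_addHaar_eq_smul_addHaar μ hL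
  have hG' : Integrable G (μ.map L) := by
    rw [hmap]
    exact hG.smul_measure ENNReal.ofReal_ne_top
  refine ⟨hG'.comp_measurable L.measurable, ?_⟩
  rw [← integral_map L.measurable.aemeasurable hG'.aestronglyMeasurable, hmap,
    integral_smul_measure, ENNReal.toReal_ofReal (abs_nonneg _), smul_eq_mul]

theorem adjoint_toEuclideanCLM {d : ℕ} (M : Matrix (Fin d) (Fin d) ℝ) :
    ContinuousLinearMap.adjoint (Matrix.toEuclideanCLM (𝕜 := ℝ) M) =
      Matrix.toEuclideanCLM (𝕜 := ℝ) Mᵀ := by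
  rw [← ContinuousLinearMap.star_eq_adjoint, ← map_star, Matrix.star_eq_conjTranspose,
    Matrix.conjTranspose_eq_transpose_of_trivial]

theorem norm_adjoint_toEuclideanLin_sq {d m : ℕ} (B : Matrix (Fin d) (Fin m) ℝ)
    (w : EuclideanSpace ℝ (Fin d)) :
    ‖ContinuousLinearMap.adjoint (LinearMap.toContinuousLinearMap (Matrix.toEuclideanLin B)) w‖ ^ 2
      = w.ofLp ⬝ᵥ (B * Bᵀ) *ᵥ w.ofLp := by
  have h : ContinuousLinearMap.adjoint
      (LinearMap.toContinuousLinearMap (Matrix.toEuclideanLin B)) w =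
      Matrix.toEuclideanLin Bᵀ w := by
    rw [← Matrix.conjTranspose_eq_transpose_of_trivial,
      Matrix.toEuclideanLin_conjTranspose_eq_adjoint]
    rfl
  rw [h, EuclideanSpace.real_norm_sq_eq, ← Matrix.mulVec_mulVec, Matrix.dotProduct_mulVec,
    ← Matrix.mulVec_transpose]
  simp [dotProduct, sq]

/-- `A C²` and its transpose `C² Aᵀ` have the same quadratic form, so the factor `1/2` disappears.
-/
theorem inner_adjoint_le_of_lyapunov {d m : ℕ} {A C : Matrix (Fin d) (Fin d) ℝ}
    {B : Matrix (Fin d) (Fin m) ℝ} (hC : Cᵀ = C)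
    (h : (1 / 2 : ℝ) • (A * C ^ 2 + C ^ 2 * Aᵀ) ≤ B * Bᵀ) (w : EuclideanSpace ℝ (Fin d)) :
    inner ℝ (Matrix.toEuclideanCLM (𝕜 := ℝ) C
        (ContinuousLinearMap.adjoint (Matrix.toEuclideanCLM (𝕜 := ℝ) A) w))
      (Matrix.toEuclideanCLM (𝕜 := ℝ) C w) ≤
    ‖ContinuousLinearMap.adjoint
      (LinearMap.toContinuousLinearMap (Matrix.toEuclideanLin B)) w‖ ^ 2 := by
  have h1 := (Matrix.le_iff.1 h).dotProduct_mulVec_nonneg w.ofLp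
  rw [norm_adjoint_toEuclideanLin_sq]
  have h2 : inner ℝ (Matrix.toEuclideanCLM (𝕜 := ℝ) C
        (ContinuousLinearMap.adjoint (Matrix.toEuclideanCLM (𝕜 := ℝ) A) w))
      (Matrix.toEuclideanCLM (𝕜 := ℝ) C w) = w.ofLp ⬝ᵥ (A * C ^ 2) *ᵥ w.ofLp := by
    rw [← ContinuousLinearMap.adjoint_inner_right, adjoint_toEuclideanCLM C, hC,
      ContinuousLinearMap.adjoint_inner_left, ← Matrix.inner_toEuclideanCLM]
    simp [sq, map_mul]
  have h3 : w.ofLp ⬝ᵥ (C ^ 2 * Aᵀ) *ᵥ w.ofLp = w.ofLp ⬝ᵥ (A * C ^ 2) *ᵥ w.ofLp := by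
    rw [Matrix.dotProduct_mulVec, ← Matrix.mulVec_transpose, dotProduct_comm,
      Matrix.transpose_mul, Matrix.transpose_pow, hC, Matrix.transpose_transpose]
  rw [h2]
  rw [star_trivial, Matrix.sub_mulVec, dotProduct_sub, Matrix.smul_mulVec, dotProduct_smul,
    Matrix.add_mulVec, dotProduct_add, h3, smul_eq_mul] at h1
  linarith

theorem integrable_gaussianWeight_mul_norm_sum_sq {d : ℕ}
    (S : EuclideanSpace ℝ (Fin d) →L[ℝ] EuclideanSpace ℝ (Fin d))
    (s : Finset (EuclideanSpace ℝ (Fin d))) (r : EuclideanSpace ℝ (Fin d) → ℝ) :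
    Integrable fun v => gaussianWeight v *
      ‖∑ x ∈ s, (r x : ℂ) * charFun (Measure.dirac x) (S v)‖ ^ 2 := by
  refine (integrable_gaussianWeight.mul_const ((∑ x ∈ s, |r x|) ^ 2)).mono'
    ?_ (Filter.Eventually.of_forall fun v => ?_)
  · have := continuous_gaussianWeight (E := EuclideanSpace ℝ (Fin d))
    refine Continuous.aestronglyMeasurable ?_
    simp only [charFun_dirac]
    fun_prop
  · rw [norm_mul, norm_pow, norm_norm, gaussianWeight, Real.norm_of_nonneg (Real.exp_pos _).le]
    gcongr
    refine norm_sum_le_of_le _ fun x _ => ?_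
    rw [norm_mul, Complex.norm_real, Real.norm_eq_abs]
    exact mul_le_of_le_one_right (abs_nonneg _) (norm_charFun_le_one _)

/-! ### The main estimate and the conclusion. -/

theorem norm_sum_meanEmbedding_le {d m : ℕ}
    {A : Matrix (Fin d) (Fin d) ℝ} {B : Matrix (Fin d) (Fin m) ℝ}
    {Ω : Type*} [MeasurableSpace Ω] {P : Measure Ω} [IsProbabilityMeasure P]
    {W : ℝ≥0 → Ω → EuclideanSpace ℝ (Fin m)} (hW : IsBrownianVec W P)
    {X : EuclideanSpace ℝ (Fin d) → ℝ≥0 → Ω → EuclideanSpace ℝ (Fin d)}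
    (hX : ∀ x, IsSolutionSDE A B W P x (X x))
    {C : Matrix (Fin d) (Fin d) ℝ} (hC : C.PosDef)
    (hABC : (1 / 2 : ℝ) • (A * C ^ 2 + C ^ 2 * Aᵀ) ≤ B * Bᵀ)
    (t : ℝ≥0) (s : Finset (EuclideanSpace ℝ (Fin d))) (r : EuclideanSpace ℝ (Fin d) → ℝ) :
    ‖∑ x ∈ s, r x • meanEmbedding C (P.map (X x t))‖ ≤
      Real.exp (t * (-A).trace / 2) * ‖∑ x ∈ s, r x • gaussianFeature C x‖ := by
  have hCt : Cᵀ = C := by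
    rw [← Matrix.conjTranspose_eq_transpose_of_trivial]; exact hC.isHermitian
  set a := Matrix.toEuclideanCLM (𝕜 := ℝ) A with ha
  set c := Matrix.toEuclideanCLM (𝕜 := ℝ) C with hc
  set S := Matrix.toEuclideanCLM (𝕜 := ℝ) C⁻¹ with hS
  set b := LinearMap.toContinuousLinearMap (Matrix.toEuclideanLin B) with hb
  have hdet : IsUnit C.det := (Matrix.isUnit_iff_isUnit_det C).1 hC.isUnit
  have hcS : c * S = 1 := by rw [hc, hS, ← map_mul, Matrix.mul_nonsing_inv C hdet, map_one]
  have hSc : S * c = 1 := by rw [hc, hS, ← map_mul, Matrix.nonsing_inv_mul C hdet, map_one]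
  have hcSv : ∀ v, c (S v) = v := fun v => congrArg (fun T => T v) hcS
  have hScv : ∀ v, S (c v) = v := fun v => congrArg (fun T => T v) hSc
  have hSlin : ∀ v, S v = Matrix.toEuclideanLin C⁻¹ v := fun v => rfl
  have hSsym : ∀ u v, inner ℝ (S u) v = inner ℝ u (S v) := by
    intro u v
    rw [← ContinuousLinearMap.adjoint_inner_right, hS, adjoint_toEuclideanCLM,
      Matrix.transpose_nonsing_inv, hCt]
  set e := NormedSpace.exp ((t : ℝ) • ContinuousLinearMap.adjoint a) with he
  set L := c * e * S with hLdef
  have hLdet : LinearMap.det (L : EuclideanSpace ℝ (Fin d) →ₗ[ℝ] EuclideanSpace ℝ (Fin d)) =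
      Real.exp (t * A.trace) := by
    have h1 : LinearMap.det (c : EuclideanSpace ℝ (Fin d) →ₗ[ℝ] EuclideanSpace ℝ (Fin d)) *
        LinearMap.det (S : EuclideanSpace ℝ (Fin d) →ₗ[ℝ] EuclideanSpace ℝ (Fin d)) = 1 := by
      rw [← LinearMap.det_comp]
      have : (c : EuclideanSpace ℝ (Fin d) →ₗ[ℝ] EuclideanSpace ℝ (Fin d)) ∘ₗ
          (S : EuclideanSpace ℝ (Fin d) →ₗ[ℝ] EuclideanSpace ℝ (Fin d)) = LinearMap.id :=
        LinearMap.ext hcSv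
      rw [this, LinearMap.det_id]
    have h2 : (L : EuclideanSpace ℝ (Fin d) →ₗ[ℝ] EuclideanSpace ℝ (Fin d)) =
        (c : EuclideanSpace ℝ (Fin d) →ₗ[ℝ] EuclideanSpace ℝ (Fin d)) ∘ₗ
        (e : EuclideanSpace ℝ (Fin d) →ₗ[ℝ] EuclideanSpace ℝ (Fin d)) ∘ₗ
        (S : EuclideanSpace ℝ (Fin d) →ₗ[ℝ] EuclideanSpace ℝ (Fin d)) := rfl
    have h3 : LinearMap.trace ℝ _ ((ContinuousLinearMap.adjoint a :
        EuclideanSpace ℝ (Fin d) →L[ℝ] EuclideanSpace ℝ (Fin d)) :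
        EuclideanSpace ℝ (Fin d) →ₗ[ℝ] EuclideanSpace ℝ (Fin d)) = A.trace := by
      rw [ha, adjoint_toEuclideanCLM, Matrix.coe_toEuclideanCLM_eq_toEuclideanLin,
        Matrix.toEuclideanLin, Matrix.toLpLin_eq_toLin, Matrix.trace_toLin_eq, Matrix.trace_transpose]
    rw [h2, LinearMap.det_comp, LinearMap.det_comp, he, det_exp_smul, h3]
    linear_combination Real.exp (t * A.trace) * h1
  have hflow : ∀ v, adjointFlow a (S v) t 0 = S (L v) := by
    intro v
    rw [adjointFlow, sub_zero, hLdef]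
    exact (hScv _).symm
  set G : EuclideanSpace ℝ (Fin d) → ℝ := fun v => gaussianWeight v *
    ‖∑ x ∈ s, (r x : ℂ) * charFun (Measure.dirac x) (S v)‖ ^ 2 with hG
  obtain ⟨hGi, hGe⟩ := integral_comp_linearMap volume L (by rw [hLdet]; positivity)
    (integrable_gaussianWeight_mul_norm_sum_sq S s r)
  have : ∀ x, IsProbabilityMeasure (P.map (X x t)) := fun x =>
    Measure.isProbabilityMeasure_map ((hX x).measurable t).aemeasurable
  have hint := integral_gaussianWeight_mul_norm_sum_charFun_sq hSlin hSsym s r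
    (fun x => P.map (X x t))
  have hint' := integral_gaussianWeight_mul_norm_sum_charFun_sq hSlin hSsym s r
    (fun x => Measure.dirac x)
  have hle : ∫ v, gaussianWeight v * ‖∑ x ∈ s, (r x : ℂ) * charFun (P.map (X x t)) (S v)‖ ^ 2 ≤
      ∫ v, G (L v) := by
    refine integral_mono_of_nonneg (Filter.Eventually.of_forall fun v => ?_) hGi
      (Filter.Eventually.of_forall fun v => ?_)
    · exact mul_nonneg (Real.exp_pos _).le (sq_nonneg _)
    · set q := ∫ u in (0 : ℝ)..t, ‖ContinuousLinearMap.adjoint b (adjointFlow a (S v) t u)‖ ^ 2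
        with hq
      have hq0 : 0 ≤ q := intervalIntegral.integral_nonneg t.coe_nonneg fun u _ => sq_nonneg _
      have hqD := norm_adjointFlow_le (inner_adjoint_le_of_lyapunov hCt hABC) (S v) t.coe_nonneg
      rw [← ha, ← hc, ← hb, ← hq, hflow, hcSv, hcSv] at hqD
      have hchar : ∀ x, (r x : ℂ) * charFun (P.map (X x t)) (S v) =
          Complex.exp (-(q : ℂ) / 2) * ((r x : ℂ) * charFun (Measure.dirac x) (S (L v))) := by
        intro x
        rw [(hX x).charFun_map hW (a := a) (fun _ => rfl) (b := b) (fun _ => rfl), hflow,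
          charFun_dirac, real_inner_comm]
        ring
      have hexp : ‖Complex.exp (-(q : ℂ) / 2)‖ ^ 2 = Real.exp (-q) := by
        have : -(q : ℂ) / 2 = ((-q / 2 : ℝ) : ℂ) := by push_cast; rfl
        rw [this, Complex.norm_exp_ofReal, sq, ← Real.exp_add]
        congr 1; ring
      simp only [hchar, ← Finset.mul_sum, hG]
      rw [norm_mul, mul_pow, hexp, ← mul_assoc]
      gcongr
      -- The inequality needed is `(‖L v‖² - ‖v‖²)/4 ≤ q`, the average of `hqD` and `hq0`.
      rw [gaussianWeight, gaussianWeight, ← Real.exp_add]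
      gcongr
      linarith
  rw [hint, hGe, hint', hLdet] at hle
  simp only [meanEmbedding_dirac] at hle
  have hZ := integral_gaussianWeight_pos (E := EuclideanSpace ℝ (Fin d))
  refine le_of_sq_le_sq ?_ (by positivity)
  have hexp : |(Real.exp (t * A.trace))⁻¹| = Real.exp (t * (-A).trace / 2) ^ 2 := by
    rw [abs_of_pos (by positivity), ← Real.exp_neg, sq, ← Real.exp_add, Matrix.trace_neg]
    congr 1; ring
  rw [mul_pow, ← hexp]
  refine le_of_mul_le_mul_left (hle.trans_eq ?_) hZ
  ring

theorem theoremt {d m : ℕ} (hmd : m ≤ d)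
    (A : Matrix (Fin d) (Fin d) ℝ) (B : Matrix (Fin d) (Fin m) ℝ)
    (hAB : Controllable A B) (hA : Hurwitz A)
    {Ω : Type*} [MeasurableSpace Ω] (P : Measure Ω) [IsProbabilityMeasure P]
    (W : ℝ≥0 → Ω → EuclideanSpace ℝ (Fin m)) (hW : IsBrownianVec W P)
    (X : EuclideanSpace ℝ (Fin d) → ℝ≥0 → Ω → EuclideanSpace ℝ (Fin d))
    (hX : ∀ x, IsSolutionSDE A B W P x (X x))
    (C : Matrix (Fin d) (Fin d) ℝ) (hC : C.PosDef)
    (hABC : (1 / 2 : ℝ) • (A * C ^ 2 + C ^ 2 * Aᵀ) ≤ B * Bᵀ)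
    (t : ℝ≥0) (f : GaussianRKHS C) :
    (∀ x, Integrable (fun ω => f (X x t ω)) P) ∧
      ∃ g : GaussianRKHS C, ⇑g = koopman P X t ⇑f ∧
        ‖g‖ ≤ Real.exp (t * (-A).trace / 2) * ‖f‖ := by
  have hXm : ∀ x, AEMeasurable (X x t) P := fun x => ((hX x).measurable t).aemeasurable
  refine ⟨fun x => Integrable.of_bound
    ((continuous_gaussianRKHS f).measurable.comp_aemeasurable (hXm x)).aestronglyMeasurable ‖f‖
    (Filter.Eventually.of_forall fun ω => abs_gaussianRKHS_le f _), ?_⟩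
  have hkoop : ∀ x, koopman P X t f x = inner ℝ f (meanEmbedding C (P.map (X x t))) := by
    intro x
    have := Measure.isProbabilityMeasure_map (hXm x)
    rw [inner_meanEmbedding, integral_map (hXm x)
      (continuous_gaussianRKHS f).measurable.aestronglyMeasurable]
    rfl
  obtain ⟨g, hg, hgn⟩ := exists_inner_eq_of_bound (gaussianFeature C) (koopman P X t f)
    (M := Real.exp (t * (-A).trace / 2) * ‖f‖) (by positivity) fun α => by
      have h1 : (α.sum fun x r => r * koopman P X t f x) =
          inner ℝ f (∑ x ∈ α.support, α x • meanEmbedding C (P.map (X x t))) := by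
        rw [inner_sum]
        exact Finset.sum_congr rfl fun x _ => by simp only [hkoop, real_inner_smul_right]
      rw [h1]
      refine (abs_real_inner_le_norm _ _).trans ?_
      have h2 := norm_sum_meanEmbedding_le hW hX hC hABC t α.support α
      calc _ ≤ ‖f‖ * (Real.exp (t * (-A).trace / 2) *
            ‖∑ x ∈ α.support, α x • gaussianFeature C x‖) := by gcongr
        _ = _ := by rw [Finsupp.sum]; ring
  exact ⟨g, funext fun x => by rw [← hg, inner_gaussianFeature_left], hgn⟩

end
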